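/- Theorem 3.7. Let $B$ be a separable real Banach space, let $(\Omega,\mathcal A,P)$ be a probability space, and let $\mathcal L(B)$ be the space of bounded linear operators on $B$ with the operator norm and its Borel $\sigma$-field. Let $(\rho_n)_{n\in\mathbb Z}$ be random elements of $\mathcal L(B)$ and $(\varepsilon_n)_{n\in\mathbb Z}$ an i.i.d. sequence of $B$-valued random variables with $E\|\varepsilon_0\|<\infty$ and $E\varepsilon_0=0$. Assume (C1(1)) the $\rho_n$, $n\in\mathbb Z$, are i.i.d. and $E\|\rho_0\|_{\mathcal L(B)}<\infty$; (C2) the sequences $(\rho_n)_{n\in\mathbb Z}$ and $(\varepsilon_n)_{n\in\mathbb Z}$ are independent of each other; (C3(1)) $E\|\rho_0\|_{\mathcal L(B)}<1$. Let $\mu\in B$ and let $(X_n)_{n\in\mathbb Z}$ be a BRCA(1) process in $L^1_B$, that is, a sequence of $B$-valued random variables with $E\|X_n\|<\infty$ for every $n$ and $$X_n-\mu=\rho_n(X_{n-1}-\mu)+\varepsilon_n\quad\text{almost surely},\qquad n\in\mathbb Z.$$ Then the sample mean $\overline X_n=\frac1n\sum_{i=1}^n X_i$ converges to $\mu$ in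 the norm of $B$, almost surely, as $n\to\infty$. -/

import Mathlib

open MeasureTheory ProbabilityTheory Filter Topology

namespace BRCA

variable {Ω B : Type*} [MeasurableSpace Ω]
  [NormedAddCommGroup B] [NormedSpace ℝ B] [MeasurableSpace B]

/-- A two-sided i.i.d. sequence of random elements of a measurable space `E`. -/
structure IsIID {E : Type*} [MeasurableSpace E] (P : Measure Ω) (ξ : ℤ → Ω → E) : Prop where
  measurable : ∀ n, Measurable (ξ n)
  indep : iIndepFun ξ P
  identDistrib : ∀ n, IdentDistrib (ξ n) (ξ 0) P P

/-- Innovations in `L¹`: an i.i.d. sequence of integrable `B`-valued random variables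
with mean zero. -/
structure IsInnovation (P : Measure Ω) (ε : ℤ → Ω → B) : Prop where
  iid : IsIID P ε
  integrable : ∀ n, Integrable (ε n) P
  mean_zero : ∫ ω, ε 0 ω ∂P = 0

/-- Condition (C1(p)): the random operators `ρ n` are i.i.d. (measurable for the Borel σ-field
of the operator norm) and `E ‖ρ n‖ ^ p < ∞`. No Bochner integrability of `ρ n` itself
is required, since `B →L[ℝ] B` need not be separable. -/
structure CondC1 (p : ℝ) (P : Measure Ω) (ρ : ℤ → Ω → (B →L[ℝ] B)) : Prop where
  iid : IsIID P ρ
  integrable_norm_rpow : ∀ n, Integrable (fun ω => ‖ρ n ω‖ ^ p) P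

/-- Condition (C2): the whole sequences `ρ` and `ε` are independent of each other. -/
def CondC2 (P : Measure Ω) (ρ : ℤ → Ω → (B →L[ℝ] B)) (ε : ℤ → Ω → B) : Prop :=
  IndepFun (fun ω n => ρ n ω) (fun ω n => ε n ω) P

/-- Condition (C3(p)): `E ‖ρ 0‖ ^ p < 1` (read together with the integrability in (C1(p))). -/
def CondC3 (p : ℝ) (P : Measure Ω) (ρ : ℤ → Ω → (B →L[ℝ] B)) : Prop :=
  ∫ ω, ‖ρ 0 ω‖ ^ p ∂P < 1

/-- `X` is a Banach-valued random coefficients autoregressive process of order one: random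
variables with `X n - μ = ρ n (X (n - 1) - μ) + ε n` almost surely, for every integer `n`. -/
structure IsBRCA1 (P : Measure Ω) (μ : B) (ρ : ℤ → Ω → (B →L[ℝ] B)) (ε X : ℤ → Ω → B) :
    Prop where
  measurable : ∀ n, Measurable (X n)
  recursion : ∀ n, ∀ᵐ ω ∂P, X n ω - μ = ρ n ω (X (n - 1) ω - μ) + ε n ω

/-- The sample mean `(X 1 + ⋯ + X n) / n`. -/
noncomputable def sampleMean (X : ℤ → Ω → B) (n : ℕ) (ω : Ω) : B :=
  (n : ℝ)⁻¹ • ∑ i ∈ Finset.Icc 1 n, X (i : ℤ) ω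

end BRCA

/-!
With `Y n = X n - μ`, unrolling the recursion from time `0` gives

`Y n = ρ n ⋯ ρ 1 (Y 0) + ∑ j < n, ρ n ⋯ ρ (n - j + 1) (ε (n - j))`,

so only the one-sided i.i.d. sequence of pairs `(ρ (k + 1), ε (k + 1))`, `k ≥ 0`, matters, together
with the arbitrary starting value `Y 0`. Everything probabilistic is done on the space of paths
`ℕ → (B →L[ℝ] B) × B` with the product measure, which the shift preserves
(`measurePreserving_shift`); write `a = E ‖ρ 0‖ < 1`.

* The starting value is forgotten: `E (‖ρ n‖ ⋯ ‖ρ 1‖) = a ^ n`, so these products are almost surely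
  summable (`ae_summable_opNormProd`), whatever the dependence of `Y 0` on the coefficients.
* For each lag `j`, the terms `ρ (i + j) ⋯ ρ (i + 1) (ε i)` form a `j`-dependent, identically
  distributed, centered and integrable sequence in `i`. The Banach-valued strong law along the
  residue classes modulo `j + 1` shows that their averages vanish (`ae_tendsto_average_chain`).
* The lags `j ≥ m` are dominated by averages along the shift of a nonnegative function whose
  integral is at most `a ^ m (1 - a)⁻¹ E ‖ε 0‖`. The weak-type bound of the maximal ergodic theorem
  (`measure_exists_birkhoffSum_gt_le`, from Garsia's inequality) makes the supremum over `n` of these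
  averages arbitrarily small for large `m` (`ae_exists_birkhoffSum_tail_le`). Thus no pointwise
  ergodic theorem is needed.

`tendsto_average_autoregression` combines the three facts for a fixed path.
-/

namespace BRCA

/-! ### Independence of paired sequences -/

/-- If each of two families is independent and the families are independent of each other, then the
family of pairs is independent: the events `f i ∈ a, g i ∈ b` form generating π-systems. -/
theorem iIndepFun_prodMk {Ω ι E F : Type*} {mΩ : MeasurableSpace Ω} [MeasurableSpace E]
    [MeasurableSpace F] {P : Measure Ω} {f : ι → Ω → E} {g : ι → Ω → F}
    (hfm : ∀ i, Measurable (f i)) (hgm : ∀ i, Measurable (g i))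
    (hf : iIndepFun f P) (hg : iIndepFun g P)
    (hfg : IndepFun (fun ω i => f i ω) (fun ω i => g i ω) P) :
    iIndepFun (fun i ω => (f i ω, g i ω)) P := by
  have hPI : IsProbabilityMeasure P := hf.isProbabilityMeasure
  let π : ι → Set (Set Ω) := fun i =>
    {s | ∃ a b, MeasurableSet a ∧ MeasurableSet b ∧ s = f i ⁻¹' a ∩ g i ⁻¹' b}
  refine iIndepSets.iIndep (π := π) (fun i => ((hfm i).prodMk (hgm i)).comap_le) ?_ ?_ ?_
  · rintro i _ ⟨a, b, ha, hb, rfl⟩ _ ⟨a', b', ha', hb', rfl⟩ -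
    refine ⟨a ∩ a', b ∩ b', ha.inter ha', hb.inter hb', ?_⟩
    ext ω
    simp only [Set.mem_inter_iff, Set.mem_preimage]
    tauto
  · intro i
    rw [← generateFrom_prod, MeasurableSpace.comap_generateFrom]
    congr 1
    ext s
    constructor
    · rintro ⟨_, ⟨a, ha, b, hb, rfl⟩, rfl⟩
      exact ⟨a, b, ha, hb, rfl⟩
    · rintro ⟨a, b, ha, hb, rfl⟩
      exact ⟨_, ⟨a, ha, b, hb, rfl⟩, rfl⟩
  · rw [iIndepSets_iff]
    intro S s hs
    have hs' : ∀ i, ∃ a b, MeasurableSet a ∧ MeasurableSet b ∧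
        (i ∈ S → s i = f i ⁻¹' a ∩ g i ⁻¹' b) := by
      intro i
      by_cases hi : i ∈ S
      · obtain ⟨a, b, ha, hb, h⟩ := hs i hi
        exact ⟨a, b, ha, hb, fun _ => h⟩
      · exact ⟨∅, ∅, MeasurableSet.empty, MeasurableSet.empty, fun h => absurd h hi⟩
    choose a b ha hb hab using hs'
    have h1 : (⋂ i ∈ S, s i) = (⋂ i ∈ S, f i ⁻¹' a i) ∩ ⋂ i ∈ S, g i ⁻¹' b i := by
      rw [Set.iInter₂_congr hab]
      ext ω
      simp only [Set.mem_iInter, Set.mem_inter_iff]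
      exact ⟨fun h => ⟨fun i hi => (h i hi).1, fun i hi => (h i hi).2⟩,
        fun h i hi => ⟨h.1 i hi, h.2 i hi⟩⟩
    have h2 : P ((⋂ i ∈ S, f i ⁻¹' a i) ∩ ⋂ i ∈ S, g i ⁻¹' b i) =
        P (⋂ i ∈ S, f i ⁻¹' a i) * P (⋂ i ∈ S, g i ⁻¹' b i) := by
      have := hfg.measure_inter_preimage_eq_mul (⋂ i ∈ S, (fun x : ι → E => x i) ⁻¹' a i)
        (⋂ i ∈ S, (fun x : ι → F => x i) ⁻¹' b i)
        (S.measurableSet_biInter fun i _ => measurable_pi_apply i (ha i))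
        (S.measurableSet_biInter fun i _ => measurable_pi_apply i (hb i))
      simpa only [Set.preimage_iInter, ← Set.preimage_comp, Function.comp_def] using this
    rw [h1, h2, hf.measure_inter_preimage_eq_mul S fun i _ => ha i,
      hg.measure_inter_preimage_eq_mul S fun i _ => hb i, ← Finset.prod_mul_distrib]
    refine Finset.prod_congr rfl fun i hi => ?_
    rw [hab i hi]
    exact ((hfg.comp (measurable_pi_apply i) (measurable_pi_apply i)).measure_inter_preimage_eq_mul
      _ _ (ha i) (hb i)).symm

/-! ### The maximal ergodic inequality -/

section MaximalErgodic

variable {α : Type*} {mα : MeasurableSpace α} {ν : Measure α}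

/-- The running maximum `max (0, S 1 f, …, S N f)` of the Birkhoff sums `S n f` of `f` along `T`,
in the recursive form `M (N + 1) = max 0 (f + M N ∘ T)`. -/
noncomputable def birkhoffMax (T : α → α) (f : α → ℝ) : ℕ → α → ℝ
  | 0, _ => 0
  | N + 1, x => max 0 (f x + birkhoffMax T f N (T x))

theorem birkhoffMax_nonneg (T : α → α) (f : α → ℝ) (N : ℕ) (x : α) :
    0 ≤ birkhoffMax T f N x := by
  cases N with
  | zero => exact le_rfl
  | succ N => exact le_max_left _ _

theorem birkhoffMax_mono (T : α → α) (f : α → ℝ) (x : α) :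
    Monotone fun N => birkhoffMax T f N x := by
  refine monotone_nat_of_le_succ fun N => ?_
  induction N generalizing x with
  | zero => exact birkhoffMax_nonneg T f 1 x
  | succ N ih => exact max_le_max le_rfl (by gcongr; exact ih (T x))

theorem birkhoffSum_le_birkhoffMax (T : α → α) (f : α → ℝ) (n : ℕ) (x : α) :
    birkhoffSum T f n x ≤ birkhoffMax T f n x := by
  induction n generalizing x with
  | zero => simp [birkhoffMax]
  | succ n ih =>
    rw [birkhoffSum_succ']
    exact le_max_of_le_right (by gcongr; exact ih (T x))

theorem integrable_birkhoffMax {T : α → α} (hT : MeasurePreserving T ν ν) {f : α → ℝ}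
    (hf : Integrable f ν) (N : ℕ) : Integrable (birkhoffMax T f N) ν := by
  induction N with
  | zero => exact integrable_zero _ _ _
  | succ N ih => exact (integrable_zero _ _ _).sup (hf.add (hT.integrable_comp_of_integrable ih))

theorem measurable_birkhoffMax {T : α → α} (hT : Measurable T) {f : α → ℝ}
    (hf : Measurable f) (N : ℕ) : Measurable (birkhoffMax T f N) := by
  induction N with
  | zero => exact measurable_const
  | succ N ih => exact measurable_const.max (hf.add (ih.comp hT))

/-- Garsia's form of the maximal ergodic theorem: where `M (N + 1) > 0` one has
`f = M (N + 1) - M N ∘ T`, and `M N ∘ T` has the same integral as `M N ≤ M (N + 1)`. -/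
theorem setIntegral_birkhoffMax_pos_nonneg {T : α → α} (hT : MeasurePreserving T ν ν) {f : α → ℝ}
    (hfm : Measurable f) (hf : Integrable f ν) (N : ℕ) :
    0 ≤ ∫ x in {x | 0 < birkhoffMax T f N x}, f x ∂ν := by
  cases N with
  | zero => simp [birkhoffMax]
  | succ N =>
    set A := {x | 0 < birkhoffMax T f (N + 1) x}
    have hA : MeasurableSet A :=
      measurableSet_lt measurable_const (measurable_birkhoffMax hT.measurable hfm _)
    have hi := integrable_birkhoffMax hT hf
    have hiT : Integrable (fun x => birkhoffMax T f N (T x)) ν :=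
      hT.integrable_comp_of_integrable (hi N)
    have h1 : ∫ x in A, f x ∂ν = ∫ x in A, birkhoffMax T f (N + 1) x ∂ν -
        ∫ x in A, birkhoffMax T f N (T x) ∂ν := by
      rw [← integral_sub (hi (N + 1)).integrableOn hiT.integrableOn]
      refine setIntegral_congr_fun hA fun x hx => ?_
      have hx' : 0 < max 0 (f x + birkhoffMax T f N (T x)) := hx
      have : max 0 (f x + birkhoffMax T f N (T x)) = f x + birkhoffMax T f N (T x) :=
        max_eq_right (by rcases lt_max_iff.1 hx' with h | h <;> linarith)
      simp only [birkhoffMax, this]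
      ring
    have h2 : ∫ x in A, birkhoffMax T f (N + 1) x ∂ν = ∫ x, birkhoffMax T f (N + 1) x ∂ν :=
      setIntegral_eq_integral_of_forall_compl_eq_zero fun x hx =>
        le_antisymm (not_lt.1 hx) (birkhoffMax_nonneg _ _ _ _)
    have h3 : ∫ x in A, birkhoffMax T f N (T x) ∂ν ≤ ∫ x, birkhoffMax T f N (T x) ∂ν :=
      setIntegral_le_integral hiT (ae_of_all _ fun x => birkhoffMax_nonneg _ _ _ _)
    have h4 : ∫ x, birkhoffMax T f N (T x) ∂ν = ∫ x, birkhoffMax T f N x ∂ν := by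
      conv_rhs => rw [← hT.map_eq]
      exact (integral_map hT.aemeasurable
        (measurable_birkhoffMax hT.measurable hfm N).aestronglyMeasurable).symm
    have h5 : ∫ x, birkhoffMax T f N x ∂ν ≤ ∫ x, birkhoffMax T f (N + 1) x ∂ν :=
      integral_mono (hi N) (hi (N + 1)) fun x => birkhoffMax_mono T f x N.le_succ
    linarith

/-- The weak-type `(1, 1)` bound for ergodic averages of a nonnegative function. -/
theorem measure_exists_birkhoffSum_gt_le [IsFiniteMeasure ν] {T : α → α}
    (hT : MeasurePreserving T ν ν) {g : α → ℝ} (hgm : Measurable g) (hg : Integrable g ν)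
    (hg0 : 0 ≤ g) {c : ℝ} (hc : 0 < c) :
    ν {x | ∃ n : ℕ, n * c < birkhoffSum T g n x} ≤ ENNReal.ofReal ((∫ x, g x ∂ν) / c) := by
  set f : α → ℝ := fun x => g x - c with hfdef
  have hfm : Measurable f := hgm.sub_const c
  have hfi : Integrable f ν := hg.sub (integrable_const c)
  have hsub : {x | ∃ n : ℕ, n * c < birkhoffSum T g n x} ⊆
      ⋃ N, {x | 0 < birkhoffMax T f N x} := by
    rintro x ⟨n, hn⟩
    refine Set.mem_iUnion.2 ⟨n, lt_of_lt_of_le ?_ (birkhoffSum_le_birkhoffMax T f n x)⟩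
    simp only [birkhoffSum, hfdef, Finset.sum_sub_distrib, Finset.sum_const, Finset.card_range,
      nsmul_eq_mul] at hn ⊢
    linarith
  have hmono : Monotone fun N => {x | 0 < birkhoffMax T f N x} :=
    fun N N' h x hx => lt_of_lt_of_le hx (birkhoffMax_mono T f x h)
  refine (measure_mono hsub).trans ?_
  rw [hmono.measure_iUnion]
  refine iSup_le fun N => ?_
  have h := setIntegral_birkhoffMax_pos_nonneg hT hfm hfi N
  set A := {x | 0 < birkhoffMax T f N x}
  rw [integral_sub hg.integrableOn (integrable_const c).integrableOn] at h
  simp only [integral_const, smul_eq_mul, measureReal_restrict_apply_univ] at h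
  have h2 : ∫ x in A, g x ∂ν ≤ ∫ x, g x ∂ν := setIntegral_le_integral hg (ae_of_all _ hg0)
  rw [← ofReal_measureReal]
  refine ENNReal.ofReal_le_ofReal ?_
  rw [le_div_iff₀ hc]
  linarith

end MaximalErgodic

/-! ### Averages along residue classes -/

/-- Cesàro averages of a sequence vanish in the limit as soon as those along each residue class
modulo `d` do. -/
theorem tendsto_average_of_residues {E : Type*} [NormedAddCommGroup E] [NormedSpace ℝ E]
    {d : ℕ} (hd : 0 < d) (u : ℕ → E)
    (h : ∀ r < d, Tendsto (fun n : ℕ => (n : ℝ)⁻¹ • ∑ q ∈ Finset.range n, u (d * q + r)) atTop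
      (𝓝 0)) :
    Tendsto (fun n : ℕ => (n : ℝ)⁻¹ • ∑ i ∈ Finset.range n, u i) atTop (𝓝 0) := by
  -- `(n + (d - 1 - r)) / d` counts the integers below `n` congruent to `r` modulo `d`.
  have key : ∀ n, ∑ i ∈ Finset.range n, u i =
      ∑ r ∈ Finset.range d, ∑ q ∈ Finset.range ((n + (d - 1 - r)) / d), u (d * q + r) := by
    intro n
    rw [← Finset.sum_fiberwise_of_maps_to (t := Finset.range d) (g := fun i => i % d)
      (fun i _ => Finset.mem_range.2 (Nat.mod_lt i hd))]
    refine Finset.sum_congr rfl fun r hr => ?_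
    have hr' := Finset.mem_range.1 hr
    have hiff : ∀ q, q < (n + (d - 1 - r)) / d ↔ d * q + r < n := by
      intro q
      rw [Nat.lt_iff_add_one_le, Nat.le_div_iff_mul_le hd, add_mul, mul_comm q d]
      omega
    refine Finset.sum_nbij' (fun i => i / d) (fun q => d * q + r) ?_ ?_ ?_ ?_ ?_
    · intro i hi
      simp only [Finset.mem_filter, Finset.mem_range] at hi ⊢
      rw [hiff, ← hi.2, Nat.div_add_mod]
      exact hi.1
    · intro q hq
      simp only [Finset.mem_filter, Finset.mem_range] at hq ⊢
      exact ⟨(hiff q).1 hq, by rw [Nat.mul_add_mod, Nat.mod_eq_of_lt hr']⟩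
    · intro i hi
      simp only [Finset.mem_filter] at hi
      rw [← hi.2, Nat.div_add_mod]
    · intro q _
      rw [Nat.mul_add_div hd, Nat.div_eq_of_lt hr', add_zero]
    · intro i hi
      simp only [Finset.mem_filter] at hi
      rw [← hi.2, Nat.div_add_mod]
  simp only [key]
  rw [← Finset.sum_const_zero (s := Finset.range d)]
  simp only [Finset.smul_sum (s := Finset.range d)]
  refine tendsto_finsetSum _ fun r hr => ?_
  have hlim : Tendsto (fun n : ℕ => (n + (d - 1 - r)) / d) atTop atTop :=
    (Nat.tendsto_div_const_atTop hd.ne').comp (tendsto_add_atTop_nat _)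
  have hr0 := (h r (Finset.mem_range.1 hr)).comp hlim
  rw [tendsto_zero_iff_norm_tendsto_zero] at hr0 ⊢
  refine squeeze_zero' (g := fun n => ((d : ℝ)) * _) (Eventually.of_forall fun n => norm_nonneg _)
    ?_ (by simpa using hr0.const_mul (d : ℝ))
  filter_upwards [eventually_ge_atTop 1] with n hn
  set k := (n + (d - 1 - r)) / d with hk
  simp only [norm_smul, norm_inv, Real.norm_natCast]
  rcases Nat.eq_zero_or_pos k with h0 | h0
  · simp [h0]
  rw [← mul_assoc]
  gcongr
  have : k ≤ d * n := by
    calc k ≤ n + (d - 1 - r) := Nat.div_le_self _ _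
      _ ≤ n + (d - 1) * n := by nlinarith [Nat.sub_le (d - 1) r]
      _ = d * n := by obtain ⟨e, rfl⟩ : ∃ e, d = e + 1 := ⟨d - 1, by omega⟩
                      simp; ring
  have h3 : (k : ℝ) ≤ d * n := by exact_mod_cast this
  have hn' : (0 : ℝ) < n := by exact_mod_cast hn
  have hk' : (0 : ℝ) < k := by exact_mod_cast h0
  rw [inv_le_iff_one_le_mul₀ hn', ← div_eq_mul_inv, div_mul_eq_mul_div, le_div_iff₀ hk']
  linarith

/-! ### The shift on one-sided sequences -/

section Shift

variable {E : Type*}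

/-- The left shift on one-sided sequences. -/
def shift (x : ℕ → E) : ℕ → E := fun n => x (n + 1)

theorem shift_iterate_apply (s : ℕ) (x : ℕ → E) (n : ℕ) : shift^[s] x n = x (n + s) := by
  induction s generalizing n with
  | zero => rfl
  | succ s ih =>
    rw [Function.iterate_succ_apply', shift, ih]
    congr 1
    omega

variable [MeasurableSpace E]

theorem measurePreserving_shift (κ : Measure E) [IsProbabilityMeasure κ] :
    MeasurePreserving (shift (E := E)) (Measure.infinitePi fun _ => κ)
      (Measure.infinitePi fun _ => κ) where
  measurable := measurable_pi_lambda _ fun n => measurable_pi_apply (n + 1)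
  map_eq := Measure.map_infinitePi_infinitePi_of_inj (P := fun _ : ℕ => κ)
    (add_left_injective 1)

/-- The σ-algebra on `ℕ → E` generated by the coordinates with index in `S`. -/
@[reducible]
def coordSigma (E : Type*) [MeasurableSpace E] (S : Set ℕ) : MeasurableSpace (ℕ → E) :=
  ⨆ k ∈ S, MeasurableSpace.comap (fun x => x k) inferInstance

theorem measurable_coord {S : Set ℕ} {k : ℕ} (hk : k ∈ S) :
    Measurable[coordSigma E S] (fun x : ℕ → E => x k) :=
  (comap_measurable _).mono
    (le_biSup (fun k => MeasurableSpace.comap (fun x : ℕ → E => x k) inferInstance) hk) le_rfl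

theorem coordSigma_le (S : Set ℕ) : coordSigma E S ≤ MeasurableSpace.pi :=
  iSup₂_le fun k _ => (measurable_pi_apply k).comap_le

theorem indepFun_of_disjoint_coord (κ : Measure E) [IsProbabilityMeasure κ] {S T : Set ℕ}
    (hST : Disjoint S T) {F G : Type*} [MeasurableSpace F] [MeasurableSpace G]
    {f : (ℕ → E) → F} {g : (ℕ → E) → G} (hf : Measurable[coordSigma E S] f)
    (hg : Measurable[coordSigma E T] g) : IndepFun f g (Measure.infinitePi fun _ => κ) := by
  have h : iIndepFun (fun (i : ℕ) (x : ℕ → E) => x i) (Measure.infinitePi fun _ => κ) :=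
    iIndepFun_infinitePi (X := fun _ x => x) fun _ => measurable_id
  have h2 : Indep (coordSigma E S) (coordSigma E T) (Measure.infinitePi fun _ => κ) :=
    indep_iSup_of_disjoint (fun k => (measurable_pi_apply k).comap_le) h hST
  rw [IndepFun_iff_Indep]
  exact indep_of_indep_of_le_left (indep_of_indep_of_le_right h2 hg.comap_le) hf.comap_le

end Shift

/-! ### Propagated innovations and their norms -/

variable {B : Type*} [NormedAddCommGroup B] [NormedSpace ℝ B]

/-- `chain j x` is `A_j (A_{j-1} (⋯ (A_1 e_0)))` where `x k = (A_k, e_k)`: the contribution of the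
innovation at time `0` to the value of the autoregression at time `j`. -/
def chain : ℕ → (ℕ → (B →L[ℝ] B) × B) → B
  | 0, x => (x 0).2
  | j + 1, x => (x (j + 1)).1 (chain j x)

/-- The product `‖A_j‖ ⋯ ‖A_1‖ ‖e_0‖`, which dominates `‖chain j x‖`. -/
noncomputable def chainNorm : ℕ → (ℕ → (B →L[ℝ] B) × B) → ℝ
  | 0, x => ‖(x 0).2‖
  | j + 1, x => ‖(x (j + 1)).1‖ * chainNorm j x

/-- The product `‖A_{n-1}‖ ⋯ ‖A_0‖`. -/
noncomputable def opNormProd : ℕ → (ℕ → (B →L[ℝ] B) × B) → ℝ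
  | 0, _ => 1
  | n + 1, x => ‖(x n).1‖ * opNormProd n x

theorem chainNorm_nonneg (j : ℕ) (x : ℕ → (B →L[ℝ] B) × B) : 0 ≤ chainNorm j x := by
  induction j with
  | zero => exact norm_nonneg _
  | succ j ih => exact mul_nonneg (norm_nonneg _) ih

theorem opNormProd_nonneg (n : ℕ) (x : ℕ → (B →L[ℝ] B) × B) : 0 ≤ opNormProd n x := by
  induction n with
  | zero => exact zero_le_one
  | succ j ih => exact mul_nonneg (norm_nonneg _) ih

theorem norm_chain_le (j : ℕ) (x : ℕ → (B →L[ℝ] B) × B) : ‖chain j x‖ ≤ chainNorm j x := by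
  induction j with
  | zero => exact le_rfl
  | succ j ih =>
    exact ((x (j + 1)).1.le_opNorm _).trans (mul_le_mul_of_nonneg_left ih (norm_nonneg _))

variable [MeasurableSpace B]

theorem measurable_opNormProd_coord (n : ℕ) {S : Set ℕ} (hS : Set.Iio n ⊆ S) :
    Measurable[coordSigma ((B →L[ℝ] B) × B) S]
      (opNormProd n : (ℕ → (B →L[ℝ] B) × B) → ℝ) := by
  induction n with
  | zero => exact @measurable_const _ _ _ (coordSigma ((B →L[ℝ] B) × B) S) 1
  | succ n ih =>
    exact (measurable_norm.comp
      (measurable_fst.comp (measurable_coord (hS (Set.mem_Iio.2 n.lt_succ_self))))).mul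
      (ih ((Set.Iio_subset_Iio n.le_succ).trans hS))

theorem measurable_opNormProd (n : ℕ) :
    Measurable (opNormProd n : (ℕ → (B →L[ℝ] B) × B) → ℝ) :=
  (measurable_opNormProd_coord n (Set.subset_univ _)).mono (coordSigma_le _) le_rfl

/-! ### Geometric moments and tails -/

section OperatorNorms

variable {κ : Measure ((B →L[ℝ] B) × B)} [IsProbabilityMeasure κ]

/-- A factor `‖A_k‖` which is independent of `f` splits off from the expectation. -/
theorem integrable_norm_mul_and_integral {f : (ℕ → (B →L[ℝ] B) × B) → ℝ} {k : ℕ} {S : Set ℕ}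
    (hk : k ∉ S) (hfm : Measurable[coordSigma ((B →L[ℝ] B) × B) S] f)
    (hA : Integrable (fun p => ‖p.1‖) κ)
    (hf : Integrable f (Measure.infinitePi fun _ => κ)) :
    Integrable (fun x => ‖(x k).1‖ * f x) (Measure.infinitePi fun _ => κ) ∧
      ∫ x, ‖(x k).1‖ * f x ∂(Measure.infinitePi fun _ => κ) =
        (∫ p, ‖p.1‖ ∂κ) * ∫ x, f x ∂(Measure.infinitePi fun _ => κ) := by
  have hind : IndepFun (fun x : ℕ → (B →L[ℝ] B) × B => ‖(x k).1‖) f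
      (Measure.infinitePi fun _ => κ) :=
    indepFun_of_disjoint_coord κ (Set.disjoint_singleton_left.2 hk)
      (measurable_norm.comp (measurable_fst.comp (measurable_coord (Set.mem_singleton k)))) hfm
  have hmp := measurePreserving_eval_infinitePi (fun _ : ℕ => κ) k
  have hi : Integrable (fun x : ℕ → (B →L[ℝ] B) × B => ‖(x k).1‖)
      (Measure.infinitePi fun _ => κ) := hmp.integrable_comp_of_integrable hA
  have hint : ∫ x : ℕ → (B →L[ℝ] B) × B, ‖(x k).1‖ ∂(Measure.infinitePi fun _ => κ) =
      ∫ p, ‖p.1‖ ∂κ := by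
    conv_rhs => rw [← hmp.map_eq]
    exact (integral_map hmp.aemeasurable measurable_fst.norm.aestronglyMeasurable).symm
  refine ⟨hind.integrable_mul hi hf, ?_⟩
  rw [← hint]
  exact hind.integral_mul_eq_mul_integral hi.aestronglyMeasurable hf.aestronglyMeasurable

theorem integrable_opNormProd_and_integral (hA : Integrable (fun p => ‖p.1‖) κ) (n : ℕ) :
    Integrable (opNormProd n) (Measure.infinitePi fun _ => κ) ∧
      ∫ x, opNormProd n x ∂(Measure.infinitePi fun _ => κ) = (∫ p, ‖p.1‖ ∂κ) ^ n := by
  induction n with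
  | zero =>
    refine ⟨integrable_const _, ?_⟩
    simp [opNormProd]
  | succ n ih =>
    obtain ⟨h1, h2⟩ := integrable_norm_mul_and_integral (κ := κ) (k := n) (S := Set.Iio n)
      (by simp) (measurable_opNormProd_coord n subset_rfl) hA ih.1
    refine ⟨h1, h2.trans ?_⟩
    rw [ih.2]
    ring

theorem ae_summable_opNormProd (hA : Integrable (fun p => ‖p.1‖) κ) (ha : ∫ p, ‖p.1‖ ∂κ < 1) :
    ∀ᵐ x ∂(Measure.infinitePi fun _ => κ), Summable fun n => opNormProd n x := by
  have ha0 : 0 ≤ ∫ p, ‖p.1‖ ∂κ := integral_nonneg fun p => norm_nonneg _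
  have hm : ∀ n, Measurable fun x : ℕ → (B →L[ℝ] B) × B => ENNReal.ofReal (opNormProd n x) :=
    fun n => (measurable_opNormProd n).ennreal_ofReal
  have hfin : ∫⁻ x : ℕ → (B →L[ℝ] B) × B, ∑' n, ENNReal.ofReal (opNormProd n x)
      ∂(Measure.infinitePi fun _ => κ) ≠ ⊤ := by
    rw [lintegral_tsum fun n => (hm n).aemeasurable]
    have : ∀ n, ∫⁻ x : ℕ → (B →L[ℝ] B) × B, ENNReal.ofReal (opNormProd n x)
        ∂(Measure.infinitePi fun _ => κ) = ENNReal.ofReal ((∫ p, ‖p.1‖ ∂κ) ^ n) := by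
      intro n
      obtain ⟨h1, h2⟩ := integrable_opNormProd_and_integral hA n
      rw [← h2, ofReal_integral_eq_lintegral_ofReal h1 (ae_of_all _ fun x => opNormProd_nonneg n x)]
    simp_rw [this]
    exact (summable_geometric_of_lt_one ha0 ha).tsum_ofReal_ne_top
  filter_upwards [ae_lt_top (Measurable.tsum hm) hfin] with x hx
  simpa only [ENNReal.toReal_ofReal (opNormProd_nonneg _ x)] using ENNReal.summable_toReal hx.ne

end OperatorNorms

variable [BorelSpace B]

theorem measurable_chainNorm_coord (j : ℕ) {S : Set ℕ} (hS : Set.Iic j ⊆ S) :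
    Measurable[coordSigma ((B →L[ℝ] B) × B) S]
      (chainNorm j : (ℕ → (B →L[ℝ] B) × B) → ℝ) := by
  induction j with
  | zero =>
    exact measurable_norm.comp
      (measurable_snd.comp (measurable_coord (hS (Set.mem_Iic.2 le_rfl))))
  | succ j ih =>
    exact (measurable_norm.comp
      (measurable_fst.comp (measurable_coord (hS (Set.mem_Iic.2 le_rfl))))).mul
      (ih ((Set.Iic_subset_Iic.2 j.le_succ).trans hS))

theorem measurable_chainNorm (j : ℕ) :
    Measurable (chainNorm j : (ℕ → (B →L[ℝ] B) × B) → ℝ) :=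
  (measurable_chainNorm_coord j (Set.subset_univ _)).mono (coordSigma_le _) le_rfl

section Moments

variable {κ : Measure ((B →L[ℝ] B) × B)} [IsProbabilityMeasure κ]

theorem integrable_chainNorm_and_integral (hA : Integrable (fun p => ‖p.1‖) κ)
    (he : Integrable (fun p => ‖p.2‖) κ) (j : ℕ) :
    Integrable (chainNorm j) (Measure.infinitePi fun _ => κ) ∧
      ∫ x, chainNorm j x ∂(Measure.infinitePi fun _ => κ) =
        (∫ p, ‖p.1‖ ∂κ) ^ j * ∫ p, ‖p.2‖ ∂κ := by
  induction j with
  | zero =>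
    have hmp := measurePreserving_eval_infinitePi (fun _ : ℕ => κ) 0
    refine ⟨hmp.integrable_comp_of_integrable he, ?_⟩
    rw [pow_zero, one_mul]
    conv_rhs => rw [← hmp.map_eq]
    exact (integral_map hmp.aemeasurable measurable_snd.norm.aestronglyMeasurable).symm
  | succ j ih =>
    obtain ⟨h1, h2⟩ := integrable_norm_mul_and_integral (κ := κ) (k := j + 1) (S := Set.Iic j)
      (by simp) (measurable_chainNorm_coord j subset_rfl) hA ih.1
    refine ⟨h1, h2.trans ?_⟩
    rw [ih.2]
    ring

/-- Uniformly in `n` and `M`, the averages of the tail `∑ m ≤ j < M, chainNorm j` are small once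
`m` is large. This is the weak-type maximal bound: the probability that the averages exceed `c`
is at most `c⁻¹ ∑ j ≥ m, E (chainNorm j)`, a geometric tail. -/
theorem ae_exists_birkhoffSum_tail_le (hA : Integrable (fun p => ‖p.1‖) κ)
    (ha : ∫ p, ‖p.1‖ ∂κ < 1) (he : Integrable (fun p => ‖p.2‖) κ) {c : ℝ} (hc : 0 < c) :
    ∀ᵐ x ∂(Measure.infinitePi fun _ => κ), ∃ m, ∀ M n : ℕ,
      birkhoffSum shift (fun y => ∑ j ∈ Finset.Ico m M, chainNorm j y) n x ≤ n * c := by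
  have ha0 : 0 ≤ ∫ p, ‖p.1‖ ∂κ := integral_nonneg fun p => norm_nonneg _
  set a := ∫ p, ‖p.1‖ ∂κ
  set e := ∫ p, ‖p.2‖ ∂κ
  have he0 : 0 ≤ e := integral_nonneg fun p => norm_nonneg _
  let g : ℕ → ℕ → (ℕ → (B →L[ℝ] B) × B) → ℝ := fun m M y => ∑ j ∈ Finset.Ico m M, chainNorm j y
  let F : ℕ → ℕ → Set (ℕ → (B →L[ℝ] B) × B) := fun m M =>
    {x | ∃ n : ℕ, n * c < birkhoffSum shift (g m M) n x}
  have hF : ∀ m M, (Measure.infinitePi fun _ => κ) (F m M) ≤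
      ENNReal.ofReal (a ^ m * ((1 - a)⁻¹ * e / c)) := by
    intro m M
    refine (measure_exists_birkhoffSum_gt_le (measurePreserving_shift κ)
      (Finset.measurable_sum _ fun j _ => measurable_chainNorm j)
      (integrable_finsetSum _ fun j _ => (integrable_chainNorm_and_integral hA he j).1)
      (fun y => Finset.sum_nonneg fun j _ => chainNorm_nonneg j y) hc).trans ?_
    refine ENNReal.ofReal_le_ofReal ?_
    rw [integral_finsetSum _ fun j _ => (integrable_chainNorm_and_integral hA he j).1]
    simp_rw [fun j => (integrable_chainNorm_and_integral hA he j).2]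
    rw [← Finset.sum_mul, ← mul_div_assoc, ← mul_assoc]
    gcongr
    rw [Finset.sum_Ico_eq_sum_range]
    simp_rw [pow_add]
    rw [← Finset.mul_sum]
    gcongr
    rw [← tsum_geometric_of_lt_one ha0 ha]
    exact (summable_geometric_of_lt_one ha0 ha).sum_le_tsum _ fun i _ => pow_nonneg ha0 i
  have hmono : ∀ m, Monotone (F m) := by
    rintro m M M' h x ⟨n, hn⟩
    refine ⟨n, hn.trans_le (Finset.sum_le_sum fun i _ => ?_)⟩
    exact Finset.sum_le_sum_of_subset_of_nonneg (Finset.Ico_subset_Ico_right h)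
      fun j _ _ => chainNorm_nonneg j _
  have hU : ∀ m, (Measure.infinitePi fun _ => κ) (⋃ M, F m M) ≤
      ENNReal.ofReal (a ^ m * ((1 - a)⁻¹ * e / c)) := by
    intro m
    rw [(hmono m).measure_iUnion]
    exact iSup_le (hF m)
  have hlim : Tendsto (fun m => ENNReal.ofReal (a ^ m * ((1 - a)⁻¹ * e / c))) atTop (𝓝 0) := by
    rw [← ENNReal.ofReal_zero]
    refine ENNReal.tendsto_ofReal ?_
    simpa using (tendsto_pow_atTop_nhds_zero_of_lt_one ha0 ha).mul_const ((1 - a)⁻¹ * e / c)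
  have hnull : (Measure.infinitePi fun _ => κ) (⋂ m, ⋃ M, F m M) = 0 :=
    le_antisymm (ge_of_tendsto' hlim fun m => (measure_mono (Set.iInter_subset _ m)).trans (hU m))
      zero_le
  filter_upwards [measure_eq_zero_iff_ae_notMem.1 hnull] with x hx
  simp only [Set.mem_iInter, Set.mem_iUnion, not_forall, not_exists] at hx
  obtain ⟨m, hm⟩ := hx
  exact ⟨m, fun M n => not_lt.1 fun h => hm M ⟨n, h⟩⟩

end Moments

/-! ### Averages of a single propagated innovation -/

section Centered

variable [TopologicalSpace.SeparableSpace B]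

/-- Evaluation of random operators at random vectors is measurable. Joint continuity of evaluation
does not suffice, as `B →L[ℝ] B` need not be second countable; the Carathéodory criterion does. -/
theorem measurable_clm_apply {α : Type*} {mα : MeasurableSpace α} {A : α → B →L[ℝ] B} {V : α → B}
    (hA : Measurable A) (hV : Measurable V) : Measurable fun a => A a (V a) := by
  have : SecondCountableTopology B := UniformSpace.secondCountable_of_separable B
  have h : Measurable (Function.uncurry fun (v : B) (T : B →L[ℝ] B) => T v) :=
    measurable_uncurry_of_continuous_of_measurable (fun T => T.continuous)
      fun v => ContinuousLinearMap.measurable_apply v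
  exact h.comp (hV.prodMk hA)

theorem integrable_clm_apply_and_integral_eq_zero [CompleteSpace B] {α : Type*}
    {mα : MeasurableSpace α} {ν : Measure α} [IsProbabilityMeasure ν] {A : α → B →L[ℝ] B}
    {V : α → B} (hA : Measurable A) (hV : Measurable V) (hAV : IndepFun A V ν)
    (hAi : Integrable (fun a => ‖A a‖) ν) (hVi : Integrable V ν) (hV0 : ∫ a, V a ∂ν = 0) :
    Integrable (fun a => A a (V a)) ν ∧ ∫ a, A a (V a) ∂ν = 0 := by
  have : SecondCountableTopology B := UniformSpace.secondCountable_of_separable B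
  have hi : Integrable (fun a => A a (V a)) ν := by
    refine Integrable.mono' ((hAV.comp measurable_norm measurable_norm).integrable_mul hAi hVi.norm)
      (measurable_clm_apply hA hV).aestronglyMeasurable (ae_of_all _ fun a => ?_)
    exact (A a).le_opNorm (V a)
  refine ⟨hi, ?_⟩
  have hpm : Measurable fun p : (B →L[ℝ] B) × B => p.1 p.2 :=
    measurable_clm_apply measurable_fst measurable_snd
  have hprod := (indepFun_iff_map_prod_eq_prod_map_map hA.aemeasurable hV.aemeasurable).1 hAV
  have hAVm : AEMeasurable (fun a => (A a, V a)) ν := (hA.prodMk hV).aemeasurable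
  have h1 : ∫ a, A a (V a) ∂ν = ∫ p, p.1 p.2 ∂(ν.map A).prod (ν.map V) := by
    rw [← hprod, integral_map hAVm hpm.aestronglyMeasurable]
  have hpi : Integrable (fun p : (B →L[ℝ] B) × B => p.1 p.2) ((ν.map A).prod (ν.map V)) := by
    rw [← hprod]
    exact (integrable_map_measure hpm.aestronglyMeasurable hAVm).2 hi
  have : IsProbabilityMeasure (ν.map A) := Measure.isProbabilityMeasure_map hA.aemeasurable
  have : IsProbabilityMeasure (ν.map V) := Measure.isProbabilityMeasure_map hV.aemeasurable
  have hid : Integrable (fun v : B => v) (ν.map V) :=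
    (integrable_map_measure measurable_id.aestronglyMeasurable hV.aemeasurable).2 hVi
  have hid0 : ∫ v, v ∂(ν.map V) = 0 := by
    exact (integral_map hV.aemeasurable measurable_id.aestronglyMeasurable).trans hV0
  rw [h1, integral_prod _ hpi]
  have : ∀ T : B →L[ℝ] B, ∫ v, T v ∂(ν.map V) = 0 := fun T => by
    rw [T.integral_comp_comm hid, hid0, map_zero]
  simp [this]

theorem measurable_chain_shift_coord (s j : ℕ) {S : Set ℕ} (hS : Set.Icc s (s + j) ⊆ S) :
    Measurable[coordSigma ((B →L[ℝ] B) × B) S]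
      (fun x : ℕ → (B →L[ℝ] B) × B => chain j (shift^[s] x)) := by
  induction j with
  | zero =>
    simp only [chain, shift_iterate_apply]
    exact measurable_snd.comp (measurable_coord (hS (by simp)))
  | succ j ih =>
    simp only [chain, shift_iterate_apply]
    exact measurable_clm_apply
      (measurable_fst.comp (measurable_coord (hS (Set.mem_Icc.2 ⟨by omega, by omega⟩))))
      (ih ((Set.Icc_subset_Icc_right (by omega)).trans hS))

theorem measurable_chain (j : ℕ) : Measurable (chain j : (ℕ → (B →L[ℝ] B) × B) → B) :=
  (measurable_chain_shift_coord 0 j (Set.subset_univ _)).mono (coordSigma_le _) le_rfl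

variable [CompleteSpace B] {κ : Measure ((B →L[ℝ] B) × B)} [IsProbabilityMeasure κ]

theorem integrable_chain_and_integral_eq_zero (hA : Integrable (fun p => ‖p.1‖) κ)
    (he : Integrable (fun p => p.2) κ) (he0 : ∫ p, p.2 ∂κ = 0) (j : ℕ) :
    Integrable (chain j) (Measure.infinitePi fun _ => κ) ∧
      ∫ x, chain j x ∂(Measure.infinitePi fun _ => κ) = 0 := by
  have : SecondCountableTopology B := UniformSpace.secondCountable_of_separable B
  induction j with
  | zero =>
    have hmp := measurePreserving_eval_infinitePi (fun _ : ℕ => κ) 0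
    refine ⟨hmp.integrable_comp_of_integrable he, ?_⟩
    rw [← he0]
    conv_rhs => rw [← hmp.map_eq]
    exact (integral_map hmp.aemeasurable measurable_snd.aestronglyMeasurable).symm
  | succ j ih =>
    have hmp := measurePreserving_eval_infinitePi (fun _ : ℕ => κ) (j + 1)
    refine integrable_clm_apply_and_integral_eq_zero
      (measurable_fst.comp (measurable_pi_apply (j + 1))) (measurable_chain j)
      (indepFun_of_disjoint_coord κ (S := {j + 1}) (T := Set.Icc 0 (0 + j)) (by simp)
        (measurable_fst.comp (measurable_coord (Set.mem_singleton _)))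
        (measurable_chain_shift_coord 0 j subset_rfl)) ?_ ih.1 ih.2
    exact hmp.integrable_comp_of_integrable hA

/-- For fixed `j`, the averages of `chain j` along the shift vanish almost surely. The variables
`chain j ∘ shift^[i]` are `j`-dependent, so the strong law applies along each residue class of `i`
modulo `j + 1`. -/
theorem ae_tendsto_average_chain (hA : Integrable (fun p => ‖p.1‖) κ)
    (he : Integrable (fun p => p.2) κ) (he0 : ∫ p, p.2 ∂κ = 0) (j : ℕ) :
    ∀ᵐ x ∂(Measure.infinitePi fun _ => κ),
      Tendsto (fun n : ℕ => (n : ℝ)⁻¹ • birkhoffSum shift (chain j) n x) atTop (𝓝 0) := by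
  have hsh := measurePreserving_shift κ
  obtain ⟨hci, hc0⟩ := integrable_chain_and_integral_eq_zero hA he he0 j
  have hslln : ∀ r : ℕ, ∀ᵐ x ∂(Measure.infinitePi fun _ => κ), Tendsto (fun n : ℕ => (n : ℝ)⁻¹ •
      ∑ q ∈ Finset.range n, chain j (shift^[(j + 1) * q + r] x)) atTop (𝓝 0) := by
    intro r
    have hmp : ∀ s, MeasurePreserving (shift^[s]) (Measure.infinitePi fun _ => κ)
        (Measure.infinitePi fun _ => κ) := fun s => hsh.iterate s
    have hid : ∀ s, IdentDistrib (fun x => chain j (shift^[s] x)) (chain j)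
        (Measure.infinitePi fun _ => κ) (Measure.infinitePi fun _ => κ) := fun s =>
      { aemeasurable_fst := ((measurable_chain j).comp (hmp s).measurable).aemeasurable
        aemeasurable_snd := (measurable_chain j).aemeasurable
        map_eq := by
          conv_rhs => rw [← (hmp s).map_eq]
          exact (Measure.map_map (measurable_chain j) (hmp s).measurable).symm }
    have h := strong_law_ae (μ := Measure.infinitePi fun _ => κ)
      (fun (q : ℕ) x => chain j (shift^[(j + 1) * q + r] x))
      ((hid _).integrable_iff.2 hci) ?_ fun q => (hid _).trans (hid _).symm
    · rwa [(hid _).integral_eq, hc0] at h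
    · intro q q' hq
      refine indepFun_of_disjoint_coord κ ?_ (measurable_chain_shift_coord _ j subset_rfl)
        (measurable_chain_shift_coord _ j subset_rfl)
      rw [Set.disjoint_left]
      intro k hk hk'
      rw [Set.mem_Icc] at hk hk'
      rcases lt_or_gt_of_ne hq with h | h
      · nlinarith
      · nlinarith
  filter_upwards [ae_all_iff.2 hslln] with x hx
  exact tendsto_average_of_residues (Nat.succ_pos j) (fun i => chain j (shift^[i] x))
    fun r _ => hx r

end Centered

/-! ### Pathwise decomposition of the autoregression -/

section Deterministic

variable {B : Type*} [NormedAddCommGroup B] [NormedSpace ℝ B]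

/-- `A_{n-1} (⋯ (A_0 v))` where `x k = (A_k, e_k)`: the contribution of the starting value `v` to
the value of the autoregression at time `n`. -/
def transient (v : B) (x : ℕ → (B →L[ℝ] B) × B) : ℕ → B
  | 0 => v
  | n + 1 => (x n).1 (transient v x n)

theorem norm_transient_le (v : B) (x : ℕ → (B →L[ℝ] B) × B) (n : ℕ) :
    ‖transient v x n‖ ≤ opNormProd n x * ‖v‖ := by
  induction n with
  | zero => simp [transient, opNormProd]
  | succ n ih =>
    rw [opNormProd, mul_assoc]
    exact ((x n).1.le_opNorm _).trans (mul_le_mul_of_nonneg_left ih (norm_nonneg _))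

/-- The unrolled recursion: the transient from time `0` plus the innovations propagated over all
lags `j`. -/
theorem autoregression_eq {Y : ℕ → B} {x : ℕ → (B →L[ℝ] B) × B}
    (hY : ∀ k, Y (k + 1) = (x k).1 (Y k) + (x k).2) (n : ℕ) :
    Y (n + 1) = transient (Y 0) x (n + 1) +
      ∑ j ∈ Finset.range (n + 1), chain j (shift^[n - j] x) := by
  induction n with
  | zero => simp [hY 0, transient, chain]
  | succ n ih =>
    rw [hY (n + 1), ih, Finset.sum_range_succ' _ (n + 1), map_add, map_sum, ← add_assoc]
    congr 1
    · congr 1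
      refine Finset.sum_congr rfl fun j hj => ?_
      have hj' := Finset.mem_range.1 hj
      rw [chain, shift_iterate_apply, Nat.add_sub_add_right]
      congr 3
      omega
    · simp [chain, shift_iterate_apply]

/-- Summing the unrolled recursion over time and grouping by the lag `j` gives Birkhoff sums along
the shift. -/
theorem sum_autoregression_eq {Y : ℕ → B} {x : ℕ → (B →L[ℝ] B) × B}
    (hY : ∀ k, Y (k + 1) = (x k).1 (Y k) + (x k).2) (N : ℕ) :
    ∑ k ∈ Finset.range N, Y (k + 1) = ∑ k ∈ Finset.range N, transient (Y 0) x (k + 1) +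
      ∑ j ∈ Finset.range N, birkhoffSum shift (chain j) (N - j) x := by
  induction N with
  | zero => simp
  | succ N ih =>
    have h : ∑ j ∈ Finset.range (N + 1), birkhoffSum shift (chain j) (N + 1 - j) x =
        ∑ j ∈ Finset.range N, birkhoffSum shift (chain j) (N - j) x +
          ∑ j ∈ Finset.range (N + 1), chain j (shift^[N - j] x) := by
      have h0 : ∑ j ∈ Finset.range N, birkhoffSum shift (chain j) (N - j) x =
          ∑ j ∈ Finset.range (N + 1), birkhoffSum shift (chain j) (N - j) x := by
        rw [Finset.sum_range_succ, Nat.sub_self, birkhoffSum_zero, add_zero]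
      rw [h0, ← Finset.sum_add_distrib]
      refine Finset.sum_congr rfl fun j hj => ?_
      have hj' := Finset.mem_range.1 hj
      rw [show N + 1 - j = N - j + 1 by omega, birkhoffSum_succ]
    rw [Finset.sum_range_succ, ih, h, Finset.sum_range_succ _ N, autoregression_eq hY N]
    abel

theorem norm_birkhoffSum_chain_le (j : ℕ) {n N : ℕ} (h : n ≤ N) (x : ℕ → (B →L[ℝ] B) × B) :
    ‖birkhoffSum shift (chain j) n x‖ ≤ birkhoffSum shift (chainNorm j) N x :=
  calc ‖birkhoffSum shift (chain j) n x‖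
      ≤ ∑ i ∈ Finset.range n, ‖chain j (shift^[i] x)‖ := norm_sum_le _ _
    _ ≤ ∑ i ∈ Finset.range n, chainNorm j (shift^[i] x) :=
      Finset.sum_le_sum fun _ _ => norm_chain_le j _
    _ ≤ birkhoffSum shift (chainNorm j) N x :=
      Finset.sum_le_sum_of_subset_of_nonneg (Finset.range_subset_range.2 h)
        fun _ _ _ => chainNorm_nonneg j _

theorem tendsto_average_shortened {f : (ℕ → (B →L[ℝ] B) × B) → B} {x : ℕ → (B →L[ℝ] B) × B}
    (h : Tendsto (fun n : ℕ => (n : ℝ)⁻¹ • birkhoffSum shift f n x) atTop (𝓝 0)) (j : ℕ) :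
    Tendsto (fun n : ℕ => (n : ℝ)⁻¹ • birkhoffSum shift f (n - j) x) atTop (𝓝 0) := by
  have h' := (h.comp (tendsto_sub_atTop_nat j)).norm
  rw [norm_zero] at h'
  refine squeeze_zero_norm (fun n => ?_) h'
  rcases Nat.eq_zero_or_pos (n - j) with h0 | h0
  · simp [h0]
  · simp only [Function.comp_apply, norm_smul, norm_inv, Real.norm_natCast]
    gcongr
    exact Nat.sub_le n j

/-- The averages of an autoregression vanish as soon as the starting value is forgotten summably,
the averages of each `chain j` vanish, and the tails in `j` are uniformly negligible. -/
theorem tendsto_average_autoregression [CompleteSpace B] {Y : ℕ → B} {x : ℕ → (B →L[ℝ] B) × B}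
    (hY : ∀ k, Y (k + 1) = (x k).1 (Y k) + (x k).2)
    (hsum : Summable fun n => opNormProd n x)
    (hchain : ∀ j, Tendsto (fun n : ℕ => (n : ℝ)⁻¹ • birkhoffSum shift (chain j) n x) atTop (𝓝 0))
    (htail : ∀ l : ℕ, ∃ m, ∀ M n : ℕ,
      birkhoffSum shift (fun y => ∑ j ∈ Finset.Ico m M, chainNorm j y) n x ≤
        n * (1 / ((l : ℝ) + 1))) :
    Tendsto (fun n : ℕ => (n : ℝ)⁻¹ • ∑ k ∈ Finset.range n, Y (k + 1)) atTop (𝓝 0) := by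
  simp only [sum_autoregression_eq hY, smul_add]
  rw [← add_zero (0 : B)]
  refine Tendsto.add ?_ ?_
  · have hs : Summable fun n => transient (Y 0) x (n + 1) :=
      (summable_nat_add_iff 1).2
        (Summable.of_norm_bounded (hsum.mul_right ‖Y 0‖) (norm_transient_le (Y 0) x))
    simpa using tendsto_inv_atTop_nhds_zero_nat (𝕜 := ℝ).smul hs.hasSum.tendsto_sum_nat
  · rw [Metric.tendsto_atTop']
    intro δ hδ
    obtain ⟨l, hl⟩ := exists_nat_one_div_lt (half_pos hδ)
    obtain ⟨m, hm⟩ := htail l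
    have hhead : Tendsto (fun n : ℕ => ∑ j ∈ Finset.range m,
        (n : ℝ)⁻¹ • birkhoffSum shift (chain j) (n - j) x) atTop (𝓝 0) := by
      simpa using tendsto_finsetSum (Finset.range m)
        fun j _ => tendsto_average_shortened (hchain j) j
    obtain ⟨N₀, hN₀⟩ := Metric.tendsto_atTop'.1 hhead (δ / 2) (half_pos hδ)
    refine ⟨max N₀ m, fun n hn => ?_⟩
    have h1 := hN₀ n ((le_max_left _ _).trans_lt hn)
    have hmn : m ≤ n := (le_max_right _ _).trans hn.le
    have hn0 : (0 : ℝ) < n := by exact_mod_cast (Nat.zero_le _).trans_lt hn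
    rw [dist_zero_right, ← Finset.smul_sum] at h1
    rw [dist_zero_right, ← Finset.sum_range_add_sum_Ico _ hmn, smul_add]
    have h2 : ‖∑ j ∈ Finset.Ico m n, birkhoffSum shift (chain j) (n - j) x‖ ≤
        n * (1 / ((l : ℝ) + 1)) :=
      calc ‖∑ j ∈ Finset.Ico m n, birkhoffSum shift (chain j) (n - j) x‖
          ≤ ∑ j ∈ Finset.Ico m n, birkhoffSum shift (chainNorm j) n x :=
            norm_sum_le_of_le _ fun j _ => norm_birkhoffSum_chain_le j (Nat.sub_le n j) x
        _ = birkhoffSum shift (fun y => ∑ j ∈ Finset.Ico m n, chainNorm j y) n x :=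
            Finset.sum_comm
        _ ≤ n * (1 / ((l : ℝ) + 1)) := hm n n
    have h3 : ‖(n : ℝ)⁻¹ • ∑ j ∈ Finset.Ico m n, birkhoffSum shift (chain j) (n - j) x‖ ≤
        1 / ((l : ℝ) + 1) := by
      rw [norm_smul, norm_inv, Real.norm_natCast, inv_mul_le_iff₀ hn0]
      exact h2
    exact (norm_add_le _ _).trans_lt (by linarith)

end Deterministic

/-! ### The law of the coefficients and innovations -/

/-- The pairs `(ρ (k + 1), ε (k + 1))`, `k ≥ 0`, form an i.i.d. sequence. -/
theorem map_pairs_eq_infinitePi {Ω : Type*} [MeasurableSpace Ω] {P : Measure Ω}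
    [IsProbabilityMeasure P] {E F : Type*} [MeasurableSpace E] [MeasurableSpace F]
    {ρ : ℤ → Ω → E} {ε : ℤ → Ω → F} (hρ : IsIID P ρ) (hε : IsIID P ε)
    (h : IndepFun (fun ω n => ρ n ω) (fun ω n => ε n ω) P) :
    P.map (fun ω (k : ℕ) => (ρ (k + 1) ω, ε (k + 1) ω)) =
      Measure.infinitePi fun _ => P.map fun ω => (ρ 0 ω, ε 0 ω) := by
  have hm : ∀ n, Measurable fun ω => (ρ n ω, ε n ω) :=
    fun n => (hρ.measurable n).prodMk (hε.measurable n)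
  have hlaw : ∀ n, P.map (fun ω => (ρ n ω, ε n ω)) = P.map fun ω => (ρ 0 ω, ε 0 ω) := by
    have hn : ∀ n, P.map (fun ω => (ρ n ω, ε n ω)) = (P.map (ρ n)).prod (P.map (ε n)) := fun n =>
      (indepFun_iff_map_prod_eq_prod_map_map (hρ.measurable n).aemeasurable
        (hε.measurable n).aemeasurable).1
        (h.comp (measurable_pi_apply n) (measurable_pi_apply n))
    intro n
    rw [hn n, hn 0, (hρ.identDistrib n).map_eq, (hε.identDistrib n).map_eq]
  have hind := iIndepFun_prodMk hρ.measurable hε.measurable hρ.indep hε.indep h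
  have hinj : Function.Injective fun k : ℕ => (k : ℤ) + 1 := fun a b hab => by simpa using hab
  rw [(hind.precomp hinj).map_fun_eq_infinitePi_map fun k => hm _]
  congr 1
  funext k
  exact hlaw _

end BRCA

theorem theorem3p7 {Ω : Type*} [MeasurableSpace Ω] (P : Measure Ω) [IsProbabilityMeasure P]
    {B : Type*} [NormedAddCommGroup B] [NormedSpace ℝ B] [CompleteSpace B]
    [TopologicalSpace.SeparableSpace B] [MeasurableSpace B] [BorelSpace B]
    (μ : B) (ρ : ℤ → Ω → (B →L[ℝ] B)) (ε X : ℤ → Ω → B)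
    (hε : BRCA.IsInnovation P ε)
    (hX : BRCA.IsBRCA1 P μ ρ ε X)
    (hX1 : ∀ n, Integrable (X n) P)
    (hC1 : BRCA.CondC1 1 P ρ)
    (hC2 : BRCA.CondC2 P ρ ε)
    (hC3 : BRCA.CondC3 1 P ρ) :
    ∀ᵐ ω ∂P, Tendsto (fun n : ℕ => BRCA.sampleMean X n ω) atTop (𝓝 μ) := by
  open BRCA in
  have : SecondCountableTopology B := UniformSpace.secondCountable_of_separable B
  have hρ1 := hC1.integrable_norm_rpow 0
  have ha : ∫ ω, ‖ρ 0 ω‖ ^ (1 : ℝ) ∂P < 1 := hC3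
  simp only [Real.rpow_one] at hρ1 ha
  have hm0 : Measurable fun ω => (ρ 0 ω, ε 0 ω) :=
    (hC1.iid.measurable 0).prodMk (hε.iid.measurable 0)
  -- The joint law of a coefficient and an innovation.
  set κ := P.map fun ω => (ρ 0 ω, ε 0 ω)
  have : IsProbabilityMeasure κ := Measure.isProbabilityMeasure_map hm0.aemeasurable
  have hA : Integrable (fun p => ‖p.1‖) κ :=
    (integrable_map_measure measurable_fst.norm.aestronglyMeasurable hm0.aemeasurable).2 hρ1
  have ha' : ∫ p, ‖p.1‖ ∂κ < 1 := by
    rwa [integral_map hm0.aemeasurable measurable_fst.norm.aestronglyMeasurable]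
  have he : Integrable (fun p => p.2) κ :=
    (integrable_map_measure measurable_snd.aestronglyMeasurable hm0.aemeasurable).2
      (hε.integrable 0)
  have he0 : ∫ p, p.2 ∂κ = 0 := by
    rw [integral_map hm0.aemeasurable measurable_snd.aestronglyMeasurable]
    exact hε.mean_zero
  have hpath : Measurable fun ω (k : ℕ) => (ρ (k + 1) ω, ε (k + 1) ω) :=
    measurable_pi_lambda _ fun k => (hC1.iid.measurable _).prodMk (hε.iid.measurable _)
  have hlaw := map_pairs_eq_infinitePi hC1.iid hε.iid hC2
  have htransfer : ∀ {p : (ℕ → (B →L[ℝ] B) × B) → Prop},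
      (∀ᵐ x ∂(Measure.infinitePi fun _ => κ), p x) →
        ∀ᵐ ω ∂P, p fun k : ℕ => (ρ (k + 1) ω, ε (k + 1) ω) := fun h =>
    ae_of_ae_map hpath.aemeasurable (hlaw ▸ h)
  filter_upwards [htransfer (ae_summable_opNormProd hA ha'),
    htransfer (ae_all_iff.2 fun j => ae_tendsto_average_chain hA he he0 j),
    htransfer (ae_all_iff.2 fun l : ℕ =>
      ae_exists_birkhoffSum_tail_le hA ha' he.norm (Nat.one_div_pos_of_nat (n := l))),
    ae_all_iff.2 hX.recursion] with ω hsum hchain htail hrec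
  have hlim := tendsto_average_autoregression (Y := fun k : ℕ => X k ω - μ)
    (fun k => by simpa using hrec (k + 1)) hsum hchain htail
  have hmean : ∀ᶠ n : ℕ in atTop, (n : ℝ)⁻¹ • ∑ k ∈ Finset.range n, (X ((k + 1 : ℕ) : ℤ) ω - μ) +
      μ = sampleMean X n ω := by
    filter_upwards [eventually_ge_atTop 1] with n hn
    have hn0 : (n : ℝ) ≠ 0 := by exact_mod_cast (Nat.one_le_iff_ne_zero.1 hn)
    rw [Finset.sum_sub_distrib, Finset.sum_const, Finset.card_range, smul_sub,
      ← Nat.cast_smul_eq_nsmul ℝ, smul_smul, inv_mul_cancel₀ hn0, one_smul, sub_add_cancel,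
      sampleMean, Finset.range_eq_Ico, Finset.sum_Ico_add' (fun i : ℕ => X (i : ℤ) ω) 0 n 1]
    rfl
  simpa using (hlim.add_const μ).congr' hmean
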